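/- For an integer $p\ge 7$ such that $p$ and $p-2$ are both prime, let $E_p$ be the elliptic curve over $\mathbb{Q}$ given by $y^2=x(x-2)(x-p)$; its Mordell–Weil rank is the rank of the abelian group $E_p(\mathbb{Q})$. The pair $(73,71)$ is a twin prime pair with $73\equiv 1 \pmod 8$, $E_{73}$ is an elliptic curve, and the Mordell–Weil rank of $E_{73}$ is zero. Consequently Beers' conjecture, that the Mordell–Weil rank of $E_p$ equals two for every $p\ge 7$ such that $p$ and $p-2$ are prime and $p\equiv 1\pmod 8$, is false. -/

import Mathlib

/-- The Weierstrass curve `y² = x (x - 2) (x - p) = x³ - (p + 2) x² + 2 p x` over `ℚ`. -/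
def twinPrimeCurve (p : ℕ) : WeierstrassCurve ℚ where
  a₁ := 0
  a₂ := -((p : ℚ) + 2)
  a₃ := 0
  a₄ := 2 * (p : ℚ)
  a₆ := 0

/-- The affine equation of `twinPrimeCurve p` is `y² = x (x - 2) (x - p)`. -/
theorem twinPrimeCurve_equation_iff (p : ℕ) (x y : ℚ) :
    (twinPrimeCurve p).toAffine.Equation x y ↔ y ^ 2 = x * (x - 2) * (x - (p : ℚ)) := by
  rw [WeierstrassCurve.Affine.equation_iff]
  simp only [twinPrimeCurve]
  constructor <;> intro h <;> linarith

/-- `twinPrimeCurve p` is an elliptic curve as soon as `p` is neither `0` nor `2`. -/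
theorem twinPrimeCurve_isElliptic (p : ℕ) (h0 : p ≠ 0) (h2 : p ≠ 2) :
    (twinPrimeCurve p).IsElliptic := by
  have h0' : (p : ℚ) ≠ 0 := by exact_mod_cast h0
  have h2' : (p : ℚ) - 2 ≠ 0 := sub_ne_zero.mpr (by exact_mod_cast h2)
  have hΔ : (twinPrimeCurve p).Δ = 64 * (p : ℚ) ^ 2 * ((p : ℚ) - 2) ^ 2 := by
    simp only [twinPrimeCurve, WeierstrassCurve.Δ, WeierstrassCurve.b₂, WeierstrassCurve.b₄,
      WeierstrassCurve.b₆, WeierstrassCurve.b₈]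
    ring
  refine ⟨?_⟩
  rw [hΔ, isUnit_iff_ne_zero]
  positivity

/-- The Mordell–Weil rank of a Weierstrass curve `E` over `ℚ`: the rank of the abelian group
`E(ℚ)` of rational points, the point at infinity included. It is a cardinal number, so that
rank `0` says that `E(ℚ)` has no `ℤ`-linearly independent element, with no junk value. -/
noncomputable def mordellWeilRank (E : WeierstrassCurve ℚ) : Cardinal :=
  Module.rank ℤ E.toAffine.Point

/-- `p ≥ 7` and `(p, p - 2)` is a pair of twin primes. -/
def IsTwinPrimePair (p : ℕ) : Prop :=
  7 ≤ p ∧ p.Prime ∧ (p - 2).Prime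

/-- Beers' conjecture in the case `p ≡ 1 (mod 8)`: the twin prime elliptic curve has
Mordell–Weil rank two. -/
def BeersConjecture : Prop :=
  ∀ p : ℕ, IsTwinPrimePair p → p ≡ 1 [MOD 8] → mordellWeilRank (twinPrimeCurve p) = 2

/-! The curve E: y² = x(x² - 75x + 146) is 2-isogenous to E': y² = x(x² + 150x + 71²), and both
descents are carried out. On E the class of x modulo squares lies in {1, 2, 73, 146}, and all four
classes come from the points of order two. On E' the class divides 71 up to sign. The classes -1, 71
and -71 each give a quartic, excluded by a second descent: the quartic is put in the form (L - N)(L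
+ N) = D K², whose factors are forced to be squares modulo 73 or 71, while the quartic itself makes
them nonsquares times squares there.

Hence every P in E(ℚ) is 2Q plus a point of order at most two, so 2E(ℚ) is 2-divisible
(`exists_two_nsmul_eq`). Instead of heights, the 2-adic valuation ends the argument: a nonzero
element of 2E(ℚ) has v₂(x) < 0, and doubling lowers v₂(x) by 2, so it cannot be halved indefinitely
inside 2E(ℚ). Thus 2E(ℚ) = 0 and the rank is zero. -/

/-! ### Residue classes forced by a factorisation -/

/-- If `a * b = D * k ^ 2` and every prime dividing `D` or both `a` and `b` is a square modulo `P`,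
then so is `a`, provided that the sign of `a` is a square modulo `P`. -/
theorem isSquare_zmod_of_mul_eq {P : ℕ} {a b D k : ℤ} (hD : D ≠ 0) (h : a * b = D * k ^ 2)
    (hDP : ∀ q : ℕ, q.Prime → (q : ℤ) ∣ D → IsSquare (q : ZMod P))
    (hab : ∀ q : ℕ, q.Prime → (q : ℤ) ∣ a → (q : ℤ) ∣ b → IsSquare (q : ZMod P))
    (hs : 0 ≤ a ∨ IsSquare (-1 : ZMod P)) : IsSquare (a : ZMod P) := by
  obtain ⟨s, m, hsm, hsq⟩ := Nat.sq_mul_squarefree a.natAbs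
  rcases eq_or_ne a 0 with rfl | ha
  · simp
  have hm0 : m ≠ 0 := by rintro rfl; simp at hsm; exact ha (by simpa using hsm.symm)
  have hs0 : s ≠ 0 := hsq.ne_zero
  have key : ∀ q : ℕ, q.Prime → q ∣ s → IsSquare (q : ZMod P) := by
    intro q hq hqs
    have hqa : (q : ℤ) ∣ a := by
      rw [Int.natCast_dvd, ← hsm]; exact hqs.mul_left _
    -- Otherwise q divides neither b nor D, so its exponent in a is even; dividing the squarefree
    -- part s makes it odd.
    by_contra hns
    have hqb : ¬ (q : ℤ) ∣ b := fun hb => hns (hab q hq hqa hb)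
    have hqD : ¬ (q : ℤ) ∣ D := fun hb => hns (hDP q hq hb)
    have hb0 : b ≠ 0 := by rintro rfl; simp at hqb
    have hk0 : k ≠ 0 := by
      rintro rfl
      have := mul_ne_zero ha hb0
      simp_all
    have : Fact q.Prime := ⟨hq⟩
    have h1 : padicValInt q (a * b) = padicValInt q (D * k ^ 2) := by rw [h]
    rw [padicValInt.mul ha hb0, padicValInt.mul hD (pow_ne_zero 2 hk0), pow_two,
      padicValInt.mul hk0 hk0, padicValInt.eq_zero_of_not_dvd hqb,
      padicValInt.eq_zero_of_not_dvd hqD] at h1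
    have h2 : padicValInt q a = 2 * padicValNat q m + padicValNat q s := by
      rw [padicValInt, ← hsm, padicValNat.mul (pow_ne_zero 2 hm0) hs0, padicValNat.pow]
    have h3 : padicValNat q s = 1 := by
      have h4 := one_le_padicValNat_of_dvd hs0 hqs
      have h5 : padicValNat q s ≤ 1 := by
        by_contra hlt
        have h6 : q ^ 2 ∣ s := (padicValNat_dvd_iff_le hs0).2 (by omega)
        rw [pow_two] at h6
        exact hq.one_lt.ne' (Nat.isUnit_iff.1 (hsq q h6))
      omega
    omega
  have hsP : IsSquare (s : ZMod P) := by
    rw [← Nat.prod_primeFactors_of_squarefree hsq, Nat.cast_prod]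
    refine Finset.isSquare_prod _ fun q hq => ?_
    exact key q (Nat.prime_of_mem_primeFactors hq) (Nat.dvd_of_mem_primeFactors hq)
  have hnP : IsSquare ((a.natAbs : ℕ) : ZMod P) := by
    rw [← hsm]; push_cast; exact (IsSquare.sq _).mul hsP
  rcases le_or_gt 0 a with h0 | h0
  · have : (a : ZMod P) = ((a.natAbs : ℤ) : ZMod P) := by rw [Int.natAbs_of_nonneg h0]
    rw [this]; simpa using hnP
  · have : (a : ZMod P) = -1 * ((a.natAbs : ℤ) : ZMod P) := by
      rw [Int.ofNat_natAbs_of_nonpos h0.le]; push_cast; ring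
    rw [this]
    exact (hs.resolve_left (by omega)).mul (by simpa using hnP)

theorem eq_zero_of_isSquare_mul_sq {F : Type*} [Field F] {a c t : F} (hc : ¬ IsSquare c)
    (h : a = c * t ^ 2) (ha : IsSquare a) : a = 0 := by
  by_contra h0
  have ht : t ≠ 0 := by rintro rfl; simp [h] at h0
  refine hc ?_
  have : c = a / t ^ 2 := by field_simp; exact h.symm
  rw [this]
  exact ha.div (IsSquare.sq t)

instance fact_prime_seventy_three : Fact (Nat.Prime 73) := ⟨by norm_num⟩

instance fact_prime_seventy_one : Fact (Nat.Prime 71) := ⟨by norm_num⟩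

theorem not_prime_dvd_of_isCoprime {M e q : ℤ} (h : IsCoprime M e) (hq : Prime q) (hM : q ∣ M)
    (he : q ∣ e) : False :=
  hq.not_isUnit (h.isUnit_of_dvd' hM he)

theorem eq_two_or_of_dvd_two_pow_mul {q k : ℕ} (r : ℕ) (hr : r.Prime) (hq : q.Prime)
    (h : (q : ℤ) ∣ 2 ^ k * r) : q = 2 ∨ q = r := by
  have h' : q ∣ 2 ^ k * r := by exact_mod_cast h
  rcases hq.dvd_mul.1 h' with h' | h'
  · exact Or.inl ((Nat.prime_dvd_prime_iff_eq hq Nat.prime_two).1 (hq.dvd_of_dvd_pow h'))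
  · exact Or.inr ((Nat.prime_dvd_prime_iff_eq hq hr).1 h')

theorem isSquare_zmod_seventy_three {q : ℕ} (h : q = 2 ∨ q = 71) : IsSquare (q : ZMod 73) := by
  rcases h with rfl | rfl
  · exact ⟨32, by decide⟩
  · exact ⟨61, by decide⟩

/-- A factorisation `a * b = D * k ^ 2` in which only `2` and `71` interfere is impossible if both
`a` and `b` are nonsquares times squares modulo `73`. -/
theorem false_of_mul_eq_mod_seventy_three {a b D k : ℤ} (hD : D ≠ 0) (h : a * b = D * k ^ 2)
    (hDP : ∀ q : ℕ, q.Prime → (q : ℤ) ∣ D → q = 2 ∨ q = 71)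
    (hab : ∀ q : ℕ, q.Prime → (q : ℤ) ∣ a → (q : ℤ) ∣ b → q = 2 ∨ q = 71)
    {c c' t t' : ZMod 73} (hc : ¬ IsSquare c) (hc' : ¬ IsSquare c')
    (ha : (a : ZMod 73) = c * t ^ 2) (hb : (b : ZMod 73) = c' * t' ^ 2) : False := by
  have hn : IsSquare (-1 : ZMod 73) := ⟨27, by decide⟩
  have h1 := eq_zero_of_isSquare_mul_sq hc ha (isSquare_zmod_of_mul_eq hD h
    (fun q hq hd => isSquare_zmod_seventy_three (hDP q hq hd))
    (fun q hq h1 h2 => isSquare_zmod_seventy_three (hab q hq h1 h2)) (Or.inr hn))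
  have h2 := eq_zero_of_isSquare_mul_sq hc' hb (isSquare_zmod_of_mul_eq hD
    ((mul_comm b a).trans h)
    (fun q hq hd => isSquare_zmod_seventy_three (hDP q hq hd))
    (fun q hq h1 h2 => isSquare_zmod_seventy_three (hab q hq h2 h1)) (Or.inr hn))
  rw [ZMod.intCast_zmod_eq_zero_iff_dvd] at h1 h2
  rcases hab 73 (by norm_num) h1 h2 with h | h <;> omega

/-! ### Second descent: the three insoluble quartics -/

/-- With A = Me and B = M² - 71e² the quartic is the conic N² = 8A² - B². The tangents at its points
(A, B, N) = (1, -2, ±2) and the chord joining them give the factorisation `hprod`. -/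
theorem quartic_neg_one_no_solution {M e N : ℤ} (hMe : IsCoprime M e)
    (h : N ^ 2 = -M ^ 4 + 150 * M ^ 2 * e ^ 2 - 5041 * e ^ 4) : False := by
  have hprod : (4 * (M * e) + (M ^ 2 - 71 * e ^ 2) - N) * (4 * (M * e) + (M ^ 2 - 71 * e ^ 2) + N)
      = 2 * (2 * (M * e) + (M ^ 2 - 71 * e ^ 2)) ^ 2 := by linear_combination -h
  have hcop : ∀ q : ℕ, q.Prime → (q : ℤ) ∣ (4 * (M * e) + (M ^ 2 - 71 * e ^ 2) - N) →
      (q : ℤ) ∣ (4 * (M * e) + (M ^ 2 - 71 * e ^ 2) + N) → q = 2 ∨ q = 71 := by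
    intro q hq h1 h2
    by_contra! hne
    have hqp : Prime (q : ℤ) := Nat.prime_iff_prime_int.1 hq
    have hq2 : ¬ (q : ℤ) ∣ 2 := fun hd => hne.1 <|
      (Nat.prime_dvd_prime_iff_eq hq Nat.prime_two).1 (by exact_mod_cast hd)
    have hq71 : ¬ (q : ℤ) ∣ 71 := fun hd => hne.2 <|
      (Nat.prime_dvd_prime_iff_eq hq (by norm_num)).1 (by exact_mod_cast hd)
    have h3 : (q : ℤ) ∣ 4 * (M * e) + (M ^ 2 - 71 * e ^ 2) := by
      refine (hqp.dvd_mul.1 (?_ : (q : ℤ) ∣ 2 * _)).resolve_left hq2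
      exact (dvd_add h1 h2).trans (dvd_of_eq (by ring))
    have h4 : (q : ℤ) ∣ 2 * (M * e) + (M ^ 2 - 71 * e ^ 2) := by
      have h5 := h1.mul_right (4 * (M * e) + (M ^ 2 - 71 * e ^ 2) + N)
      rw [hprod] at h5
      exact hqp.dvd_of_dvd_pow ((hqp.dvd_mul.1 h5).resolve_left hq2)
    have h5 : (q : ℤ) ∣ M * e := by
      refine (hqp.dvd_mul.1 (?_ : (q : ℤ) ∣ 2 * _)).resolve_left hq2
      exact (dvd_sub h3 h4).trans (dvd_of_eq (by ring))
    have h6 : (q : ℤ) ∣ M ^ 2 - 71 * e ^ 2 := by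
      exact (dvd_sub h3 (h5.mul_left 4)).trans (dvd_of_eq (by ring))
    rcases hqp.dvd_mul.1 h5 with hM | he
    · have h7 : (q : ℤ) ∣ 71 * e ^ 2 := by
        exact (dvd_sub (dvd_pow hM two_ne_zero) h6).trans (dvd_of_eq (by ring))
      exact not_prime_dvd_of_isCoprime hMe hqp hM
        (hqp.dvd_of_dvd_pow ((hqp.dvd_mul.1 h7).resolve_left hq71))
    · have h7 : (q : ℤ) ∣ M ^ 2 := by
        exact (dvd_add h6 ((dvd_pow he two_ne_zero).mul_left 71)).trans (dvd_of_eq (by ring))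
      exact not_prime_dvd_of_isCoprime hMe hqp (hqp.dvd_of_dvd_pow h7) he
  have hD : ∀ q : ℕ, q.Prime → (q : ℤ) ∣ 2 → q = 2 ∨ q = 71 := fun q hq hd =>
    eq_two_or_of_dvd_two_pow_mul (k := 1) 71 (by norm_num) hq (hd.mul_right _)
  have h73 : (73 : ZMod 73) = 0 := by decide
  have hz : (N : ZMod 73) ^ 2 = -(M : ZMod 73) ^ 4 + 150 * (M : ZMod 73) ^ 2 * (e : ZMod 73) ^ 2
      - 5041 * (e : ZMod 73) ^ 4 := by exact_mod_cast congrArg (Int.cast : ℤ → ZMod 73) h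
  -- Modulo 73 the quartic is -(M² - 2e²)², and 27² = -1. Substituting N turns the two factors into
  -- -26 and 28 times squares of linear forms.
  have hN : ((N : ZMod 73) - 27 * (M ^ 2 - 2 * e ^ 2)) * (N + 27 * (M ^ 2 - 2 * e ^ 2)) = 0 := by
    linear_combination hz + (-10 * (M : ZMod 73) ^ 4 + 42 * (M : ZMod 73) ^ 2 * (e : ZMod 73) ^ 2
      - 109 * (e : ZMod 73) ^ 4) * h73
  have n1 : ¬ IsSquare (-26 : ZMod 73) := by decide
  have n2 : ¬ IsSquare (28 : ZMod 73) := by decide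
  rcases mul_eq_zero.1 hN with hN | hN
  · refine false_of_mul_eq_mod_seventy_three two_ne_zero hprod hD hcop n1 n2
      (t := M + 28 * e) (t' := M + 47 * e) ?_ ?_
    · push_cast
      linear_combination -hN + (20 * (M : ZMod 73) * e + 279 * (e : ZMod 73) ^ 2) * h73
    · push_cast
      linear_combination hN - (36 * (M : ZMod 73) * e + 849 * (e : ZMod 73) ^ 2) * h73
  · refine false_of_mul_eq_mod_seventy_three two_ne_zero hprod hD hcop n2 n1
      (t := M + 47 * e) (t' := M + 28 * e) ?_ ?_
    · push_cast
      linear_combination -hN - (36 * (M : ZMod 73) * e + 849 * (e : ZMod 73) ^ 2) * h73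
    · push_cast
      linear_combination hN + (20 * (M : ZMod 73) * e + 279 * (e : ZMod 73) ^ 2) * h73

/-- Here A = Me and B = M² - e² give the conic N² = 8A² - 71B², with tangents taken at (3, -1, ±1).
-/
theorem quartic_neg_seventy_one_no_solution {M e N : ℤ} (hMe : IsCoprime M e)
    (h : N ^ 2 = -71 * M ^ 4 + 150 * M ^ 2 * e ^ 2 - 71 * e ^ 4) : False := by
  have hprod : (24 * (M * e) + 71 * (M ^ 2 - e ^ 2) - N) * (24 * (M * e) + 71 * (M ^ 2 - e ^ 2) + N)
      = 568 * (M * e + 3 * (M ^ 2 - e ^ 2)) ^ 2 := by linear_combination -h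
  have hD : ∀ q : ℕ, q.Prime → (q : ℤ) ∣ 568 → q = 2 ∨ q = 71 := fun q hq hd =>
    eq_two_or_of_dvd_two_pow_mul (k := 3) 71 (by norm_num) hq hd
  have hcop : ∀ q : ℕ, q.Prime → (q : ℤ) ∣ (24 * (M * e) + 71 * (M ^ 2 - e ^ 2) - N) →
      (q : ℤ) ∣ (24 * (M * e) + 71 * (M ^ 2 - e ^ 2) + N) → q = 2 ∨ q = 71 := by
    intro q hq h1 h2
    by_contra hne
    have hqp : Prime (q : ℤ) := Nat.prime_iff_prime_int.1 hq
    have hqD : ¬ (q : ℤ) ∣ 568 := fun hd => hne (hD q hq hd)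
    have hq2 : ¬ (q : ℤ) ∣ 2 := fun hd => hqD (hd.trans (by norm_num))
    have h3 : (q : ℤ) ∣ 24 * (M * e) + 71 * (M ^ 2 - e ^ 2) := by
      refine (hqp.dvd_mul.1 (?_ : (q : ℤ) ∣ 2 * _)).resolve_left hq2
      exact (dvd_add h1 h2).trans (dvd_of_eq (by ring))
    have h4 : (q : ℤ) ∣ M * e + 3 * (M ^ 2 - e ^ 2) := by
      have h5 := h1.mul_right (24 * (M * e) + 71 * (M ^ 2 - e ^ 2) + N)
      rw [hprod] at h5
      exact hqp.dvd_of_dvd_pow ((hqp.dvd_mul.1 h5).resolve_left hqD)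
    have h6 : (q : ℤ) ∣ M ^ 2 - e ^ 2 := by
      exact (dvd_sub (h4.mul_left 24) h3).trans (dvd_of_eq (by ring))
    have h5 : (q : ℤ) ∣ M * e := by
      exact (dvd_sub h4 (h6.mul_left 3)).trans (dvd_of_eq (by ring))
    rcases hqp.dvd_mul.1 h5 with hM | he
    · have h7 : (q : ℤ) ∣ e ^ 2 := by
        exact (dvd_sub (dvd_pow hM two_ne_zero) h6).trans (dvd_of_eq (by ring))
      exact not_prime_dvd_of_isCoprime hMe hqp hM (hqp.dvd_of_dvd_pow h7)
    · have h7 : (q : ℤ) ∣ M ^ 2 := by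
        exact (dvd_add h6 (dvd_pow he two_ne_zero)).trans (dvd_of_eq (by ring))
      exact not_prime_dvd_of_isCoprime hMe hqp (hqp.dvd_of_dvd_pow h7) he
  have h73 : (73 : ZMod 73) = 0 := by decide
  have hz : (N : ZMod 73) ^ 2 = -71 * (M : ZMod 73) ^ 4 + 150 * (M : ZMod 73) ^ 2 *
      (e : ZMod 73) ^ 2 - 71 * (e : ZMod 73) ^ 4 := by
    exact_mod_cast congrArg (Int.cast : ℤ → ZMod 73) h
  -- Modulo 73 the quartic is 2(M² + e²)², and 32² = 2.
  have hN : ((N : ZMod 73) - 32 * (M ^ 2 + e ^ 2)) * (N + 32 * (M ^ 2 + e ^ 2)) = 0 := by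
    linear_combination hz + (-15 * (M : ZMod 73) ^ 4 - 26 * (M : ZMod 73) ^ 2 * (e : ZMod 73) ^ 2
      - 15 * (e : ZMod 73) ^ 4) * h73
  have n1 : ¬ IsSquare (39 : ZMod 73) := by decide
  have n2 : ¬ IsSquare (103 : ZMod 73) := by decide
  have h568 : (568 : ℤ) ≠ 0 := by norm_num
  rcases mul_eq_zero.1 hN with hN | hN
  · refine false_of_mul_eq_mod_seventy_three h568 hprod hD hcop n1 n2
      (t := M + 34 * e) (t' := M + 15 * e) ?_ ?_
    · push_cast
      linear_combination -hN - (36 * (M : ZMod 73) * e + 619 * (e : ZMod 73) ^ 2) * h73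
    · push_cast
      linear_combination hN - (42 * (M : ZMod 73) * e + 318 * (e : ZMod 73) ^ 2) * h73
  · refine false_of_mul_eq_mod_seventy_three h568 hprod hD hcop n2 n1
      (t := M + 15 * e) (t' := M + 34 * e) ?_ ?_
    · push_cast
      linear_combination -hN - (42 * (M : ZMod 73) * e + 318 * (e : ZMod 73) ^ 2) * h73
    · push_cast
      linear_combination hN - (36 * (M : ZMod 73) * e + 619 * (e : ZMod 73) ^ 2) * h73

theorem isSquare_zmod_seventy_one {q : ℕ} (h : q = 2 ∨ q = 73) : IsSquare (q : ZMod 71) := by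
  rcases h with rfl | rfl <;> exact ⟨12, by decide⟩

/-- The conic is now in (M², e², N), with tangents at (7, -5, ±2). The obstruction is modulo 71,
where -1 is not a square, so the factors must also be shown nonnegative. -/
theorem quartic_seventy_one_no_solution {M e N : ℤ} (hMe : IsCoprime M e)
    (h : N ^ 2 = 71 * M ^ 4 + 150 * M ^ 2 * e ^ 2 + 71 * e ^ 4) : False := by
  have hprod : (61 * M ^ 2 + 85 * e ^ 2 - N) * (61 * M ^ 2 + 85 * e ^ 2 + N)
      = 146 * (5 * M ^ 2 + 7 * e ^ 2) ^ 2 := by linear_combination -h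
  have hD : ∀ q : ℕ, q.Prime → (q : ℤ) ∣ 146 → q = 2 ∨ q = 73 := fun q hq hd =>
    eq_two_or_of_dvd_two_pow_mul (k := 1) 73 (by norm_num) hq hd
  have hcop : ∀ q : ℕ, q.Prime → (q : ℤ) ∣ (61 * M ^ 2 + 85 * e ^ 2 - N) →
      (q : ℤ) ∣ (61 * M ^ 2 + 85 * e ^ 2 + N) → q = 2 ∨ q = 73 := by
    intro q hq h1 h2
    by_contra hne
    have hqp : Prime (q : ℤ) := Nat.prime_iff_prime_int.1 hq
    have hqD : ¬ (q : ℤ) ∣ 146 := fun hd => hne (hD q hq hd)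
    have hq2 : ¬ (q : ℤ) ∣ 2 := fun hd => hqD (hd.trans (by norm_num))
    have h3 : (q : ℤ) ∣ 61 * M ^ 2 + 85 * e ^ 2 := by
      refine (hqp.dvd_mul.1 (?_ : (q : ℤ) ∣ 2 * _)).resolve_left hq2
      exact (dvd_add h1 h2).trans (dvd_of_eq (by ring))
    have h4 : (q : ℤ) ∣ 5 * M ^ 2 + 7 * e ^ 2 := by
      have h5 := h1.mul_right (61 * M ^ 2 + 85 * e ^ 2 + N)
      rw [hprod] at h5
      exact hqp.dvd_of_dvd_pow ((hqp.dvd_mul.1 h5).resolve_left hqD)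
    have h5 : (q : ℤ) ∣ M ^ 2 := by
      refine (hqp.dvd_mul.1 (?_ : (q : ℤ) ∣ 2 * _)).resolve_left hq2
      exact (dvd_sub (h3.mul_left 7) (h4.mul_left 85)).trans (dvd_of_eq (by ring))
    have h6 : (q : ℤ) ∣ e ^ 2 := by
      refine (hqp.dvd_mul.1 (?_ : (q : ℤ) ∣ 2 * _)).resolve_left hq2
      exact (dvd_sub (h4.mul_left 61) (h3.mul_left 5)).trans (dvd_of_eq (by ring))
    exact not_prime_dvd_of_isCoprime hMe hqp (hqp.dvd_of_dvd_pow h5) (hqp.dvd_of_dvd_pow h6)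
  have hpos : 0 < 61 * M ^ 2 + 85 * e ^ 2 := by
    rcases eq_or_ne M 0 with rfl | hM
    · have : e ≠ 0 := by rintro rfl; exact not_isCoprime_zero_zero hMe
      positivity
    · positivity
  have hnn : 0 ≤ (61 * M ^ 2 + 85 * e ^ 2 - N) * (61 * M ^ 2 + 85 * e ^ 2 + N) := by
    rw [hprod]; positivity
  have ha : 0 ≤ 61 * M ^ 2 + 85 * e ^ 2 - N := by
    by_contra! hlt
    nlinarith
  have hb : 0 ≤ 61 * M ^ 2 + 85 * e ^ 2 + N := by
    by_contra! hlt
    nlinarith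
  have h146 : (146 : ℤ) ≠ 0 := by norm_num
  have sa := isSquare_zmod_of_mul_eq h146 hprod
    (fun q hq hd => isSquare_zmod_seventy_one (hD q hq hd))
    (fun q hq h1 h2 => isSquare_zmod_seventy_one (hcop q hq h1 h2)) (Or.inl ha)
  have sb := isSquare_zmod_of_mul_eq h146 ((mul_comm _ _).trans hprod)
    (fun q hq hd => isSquare_zmod_seventy_one (hD q hq hd))
    (fun q hq h1 h2 => isSquare_zmod_seventy_one (hcop q hq h2 h1)) (Or.inl hb)
  have h71 : (71 : ZMod 71) = 0 := by decide
  have hz : (N : ZMod 71) ^ 2 = 71 * (M : ZMod 71) ^ 4 + 150 * (M : ZMod 71) ^ 2 *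
      (e : ZMod 71) ^ 2 + 71 * (e : ZMod 71) ^ 4 := by
    exact_mod_cast congrArg (Int.cast : ℤ → ZMod 71) h
  -- Modulo 71 the quartic is 8M²e², and 24² = 8.
  have hN : ((N : ZMod 71) - 24 * (M * e)) * (N + 24 * (M * e)) = 0 := by
    linear_combination hz + ((M : ZMod 71) ^ 4 - 6 * (M : ZMod 71) ^ 2 * (e : ZMod 71) ^ 2
      + (e : ZMod 71) ^ 4) * h71
  have n1 : ¬ IsSquare (-10 : ZMod 71) := by decide
  have hfin : ∀ c : ZMod 71,
      ((61 * M ^ 2 + 85 * e ^ 2 - N : ℤ) : ZMod 71) = -10 * (M - c * e) ^ 2 →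
      ((61 * M ^ 2 + 85 * e ^ 2 + N : ℤ) : ZMod 71) = -10 * (M + c * e) ^ 2 → False := by
    intro c h1 h2
    have z1 := eq_zero_of_isSquare_mul_sq n1 h1 sa
    have z2 := eq_zero_of_isSquare_mul_sq n1 h2 sb
    rw [ZMod.intCast_zmod_eq_zero_iff_dvd] at z1 z2
    rcases hcop 71 (by norm_num) z1 z2 with h | h <;> omega
  rcases mul_eq_zero.1 hN with hN | hN
  · refine hfin 13 ?_ ?_
    · push_cast
      linear_combination -hN + ((M : ZMod 71) ^ 2 - 4 * M * e + 25 * (e : ZMod 71) ^ 2) * h71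
    · push_cast
      linear_combination hN + ((M : ZMod 71) ^ 2 + 4 * M * e + 25 * (e : ZMod 71) ^ 2) * h71
  · refine hfin (-13) ?_ ?_
    · push_cast
      linear_combination -hN + ((M : ZMod 71) ^ 2 + 4 * M * e + 25 * (e : ZMod 71) ^ 2) * h71
    · push_cast
      linear_combination hN + ((M : ZMod 71) ^ 2 - 4 * M * e + 25 * (e : ZMod 71) ^ 2) * h71

/-! ### First descent on both curves -/

/-- Every nonzero rational number is a squarefree integer times a nonzero square. -/
theorem exists_squarefree_mul_sq {x : ℚ} (hx : x ≠ 0) :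
    ∃ (d : ℤ) (z : ℚ), Squarefree d ∧ z ≠ 0 ∧ x = d * z ^ 2 := by
  obtain ⟨s, m, hsm, hsq⟩ := Nat.sq_mul_squarefree (x.num * x.den).natAbs
  have hden : (x.den : ℚ) ≠ 0 := by exact_mod_cast x.den_nz
  have hne : x.num * x.den ≠ 0 :=
    mul_ne_zero (Rat.num_ne_zero.2 hx) (by exact_mod_cast x.den_nz)
  have hm0 : m ≠ 0 := by
    rintro rfl
    exact hne (Int.natAbs_eq_zero.1 (by simpa using hsm.symm))
  have hx' : x = ((x.num * x.den : ℤ) : ℚ) / (x.den : ℚ) ^ 2 := by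
    push_cast
    conv_lhs => rw [← Rat.num_div_den x]
    field_simp
  have hz : (m : ℚ) / x.den ≠ 0 := div_ne_zero (by exact_mod_cast hm0) hden
  rcases Int.natAbs_eq (x.num * x.den) with h | h
  · refine ⟨s, m / x.den, Int.squarefree_natCast.2 hsq, hz, ?_⟩
    rw [← hsm] at h
    rw [h] at hx'
    refine hx'.trans ?_
    push_cast; ring
  · refine ⟨-s, m / x.den, by
      rw [← Int.squarefree_natAbs]; simpa using hsq, hz, ?_⟩
    rw [← hsm] at h
    rw [h] at hx'
    refine hx'.trans ?_
    push_cast; ring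

/-- The descent by the `2`-isogeny with kernel `(0, 0)`. -/
theorem exists_quartic_of_point {a b : ℤ} {x y : ℚ} (hx : x ≠ 0)
    (h : y ^ 2 = x * (x ^ 2 + a * x + b)) :
    ∃ (d M e N : ℤ), Squarefree d ∧ d ∣ b ∧ IsCoprime M e ∧ (∃ z : ℚ, z ≠ 0 ∧ x = d * z ^ 2) ∧
      d * N ^ 2 = d ^ 2 * M ^ 4 + a * d * M ^ 2 * e ^ 2 + b * e ^ 4 := by
  obtain ⟨d, z, hd, hz, hxz⟩ := exists_squarefree_mul_sq hx
  have hcop : IsCoprime z.num (z.den : ℤ) := by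
    rw [Int.isCoprime_iff_nat_coprime]; simpa using z.reduced
  set M := z.num with hM
  set e : ℤ := (z.den : ℤ) with he
  have he0 : (e : ℚ) ≠ 0 := by rw [he]; exact_mod_cast z.den_nz
  have hzMe : z = M / e := by rw [hM, he]; exact_mod_cast (Rat.num_div_den z).symm
  have hsq : IsSquare (((d * (d ^ 2 * M ^ 4 + a * d * M ^ 2 * e ^ 2 + b * e ^ 4) : ℤ)) : ℚ) := by
    refine ⟨y * e ^ 2 / z, ?_⟩
    have h1 : y * e ^ 2 / z * (y * e ^ 2 / z) = y ^ 2 * e ^ 4 / z ^ 2 := by ring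
    have h2 : (M : ℚ) = z * e := by rw [hzMe]; field_simp
    rw [h1, h, hxz]
    push_cast
    rw [h2]
    field_simp
  rw [Rat.isSquare_intCast_iff] at hsq
  obtain ⟨N₁, hN₁⟩ := hsq
  have hdN : d ∣ N₁ := by
    rw [← hd.dvd_pow_iff_dvd two_ne_zero, pow_two, ← hN₁]
    exact dvd_mul_right _ _
  obtain ⟨N, rfl⟩ := hdN
  have hd0 : d ≠ 0 := hd.ne_zero
  have hq : d * N ^ 2 = d ^ 2 * M ^ 4 + a * d * M ^ 2 * e ^ 2 + b * e ^ 4 := by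
    apply mul_left_cancel₀ hd0
    rw [hN₁]; ring
  -- A common prime q of d and e would divide N, and then M because q² does not divide d.
  have hde : IsCoprime d e := by
    refine isCoprime_of_prime_dvd (fun h => hd0 h.1) ?_
    rintro q hqp ⟨d', hd'⟩ ⟨e', he'⟩
    have hq0 : q ≠ 0 := hqp.ne_zero
    have hqd' : ¬ q ∣ d' := by
      rintro ⟨d'', rfl⟩
      exact hqp.not_isUnit (hd q ⟨d'', by rw [hd']; ring⟩)
    have hqM : ¬ q ∣ M := fun hqM => not_prime_dvd_of_isCoprime hcop hqp hqM ⟨e', he'⟩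
    rw [hd', he'] at hq
    have h1 : d' * N ^ 2 = q * (d' ^ 2 * M ^ 4 + q * (a * d' * M ^ 2 * e' ^ 2 + q * b * e' ^ 4)) := by
      apply mul_left_cancel₀ hq0
      linear_combination hq
    have h2 : q ∣ N := hqp.dvd_of_dvd_pow
      ((hqp.dvd_mul.1 (h1 ▸ dvd_mul_right q _)).resolve_left hqd')
    obtain ⟨N', rfl⟩ := h2
    have h3 : d' ^ 2 * M ^ 4 = q * (d' * N' ^ 2 - (a * d' * M ^ 2 * e' ^ 2 + q * b * e' ^ 4)) := by
      apply mul_left_cancel₀ hq0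
      linear_combination -h1
    rcases hqp.dvd_mul.1 (h3 ▸ dvd_mul_right q _) with h4 | h4
    · exact hqd' (hqp.dvd_of_dvd_pow h4)
    · exact hqM (hqp.dvd_of_dvd_pow h4)
  refine ⟨d, M, e, N, hd, ?_, hcop, ⟨z, hz, hxz⟩, hq⟩
  have h1 : d ∣ b * e ^ 4 :=
    ⟨N ^ 2 - (d * M ^ 4 + a * M ^ 2 * e ^ 2), by linear_combination -hq⟩
  exact hde.pow_right.dvd_of_dvd_mul_right h1

/-- On `y² = x (x² + 150 x + 71²)` the `x`-coordinate of a rational point is a square. -/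
theorem isSquare_of_isogenous_point {x y : ℚ} (h : y ^ 2 = x * (x ^ 2 + 150 * x + 5041)) :
    IsSquare x := by
  rcases eq_or_ne x 0 with rfl | hx
  · simp
  obtain ⟨d, M, e, N, hd, hdb, hcop, ⟨z, -, hxz⟩, hq⟩ :=
    exists_quartic_of_point (a := 150) (b := 5041) hx (by exact_mod_cast h)
  have hd71 : d ∣ 71 := by
    rw [show (5041 : ℤ) = 71 ^ 2 by norm_num] at hdb
    exact (hd.dvd_pow_iff_dvd two_ne_zero).1 hdb
  have hcases : d = 1 ∨ d = -1 ∨ d = 71 ∨ d = -71 := by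
    have h1 : d.natAbs ∣ 71 := Int.natAbs_dvd_natAbs.2 hd71
    rcases (Nat.dvd_prime (by norm_num)).1 h1 with h1 | h1 <;> omega
  rcases hcases with rfl | rfl | rfl | rfl
  · exact ⟨z, by rw [hxz]; push_cast; ring⟩
  · exact (quartic_neg_one_no_solution (N := N) hcop (by linarith)).elim
  · exact (quartic_seventy_one_no_solution (N := N) hcop (by linarith)).elim
  · exact (quartic_neg_seventy_one_no_solution (N := N) hcop (by linarith)).elim

/-- On `y² = x (x - 2) (x - 73)` the `x`-coordinate of a rational point with `x ≠ 0` is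
`1`, `2`, `73` or `146` times a square. -/
theorem exists_eq_mul_sq_of_point {x y : ℚ} (hx : x ≠ 0) (h : y ^ 2 = x * (x - 2) * (x - 73)) :
    ∃ z : ℚ, z ≠ 0 ∧ (x = z ^ 2 ∨ x = 2 * z ^ 2 ∨ x = 73 * z ^ 2 ∨ x = 146 * z ^ 2) := by
  obtain ⟨d, M, e, N, hd, hdb, hcop, ⟨z, hz, hxz⟩, hq⟩ :=
    exists_quartic_of_point (a := -75) (b := 146) (y := y) hx (by push_cast; rw [h]; ring)
  have hpos : 0 < x := by
    by_contra! hle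
    have hlt : x < 0 := lt_of_le_of_ne hle hx
    have : 0 < (x - 2) * (x - 73) := mul_pos_of_neg_of_neg (by linarith) (by linarith)
    nlinarith [sq_nonneg y, mul_pos_of_neg_of_neg hlt (neg_neg_of_pos this)]
  have hdpos : 0 < d := by
    by_contra! hle
    have : (d : ℚ) ≤ 0 := by exact_mod_cast hle
    nlinarith [sq_nonneg z, mul_nonneg (neg_nonneg.2 this) (sq_nonneg z)]
  have hcases : d = 1 ∨ d = 2 ∨ d = 73 ∨ d = 146 := by
    lift d to ℕ using hdpos.le
    have h1 : d ∈ Nat.divisors 146 := by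
      rw [Nat.mem_divisors]; exact ⟨by exact_mod_cast hdb, by norm_num⟩
    have h2 : Nat.divisors 146 = {1, 2, 73, 146} := by decide +kernel
    rw [h2] at h1
    have h3 : d = 1 ∨ d = 2 ∨ d = 73 ∨ d = 146 := by simpa using h1
    exact_mod_cast h3
  refine ⟨z, hz, ?_⟩
  rcases hcases with rfl | rfl | rfl | rfl <;> simp [hxz]

/-! ### Group law and halving of points -/

namespace TwinPrimeCurve

open WeierstrassCurve.Affine (Point)

instance isElliptic_seventy_three : (twinPrimeCurve 73).IsElliptic :=
  twinPrimeCurve_isElliptic 73 (by norm_num) (by norm_num)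

theorem nonsingular_iff {x y : ℚ} :
    (twinPrimeCurve 73).toAffine.Nonsingular x y ↔ y ^ 2 = x * (x - 2) * (x - 73) := by
  rw [← WeierstrassCurve.Affine.equation_iff_nonsingular, twinPrimeCurve_equation_iff]
  norm_num

theorem negY_eq (x y : ℚ) : (twinPrimeCurve 73).toAffine.negY x y = -y := by
  simp [WeierstrassCurve.Affine.negY, twinPrimeCurve]

theorem addX_eq (x₁ x₂ l : ℚ) :
    (twinPrimeCurve 73).toAffine.addX x₁ x₂ l = l ^ 2 + 75 - x₁ - x₂ := by
  simp only [WeierstrassCurve.Affine.addX, twinPrimeCurve]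
  push_cast; ring

theorem some_zero_add_self {x : ℚ} (h : (twinPrimeCurve 73).toAffine.Nonsingular x 0) :
    Point.some x 0 h + Point.some x 0 h = 0 :=
  Point.add_self_of_Y_eq (by rw [negY_eq, neg_zero])

/-- Translation by a point of order two. -/
theorem exists_add_some_zero {x y c : ℚ} (h : (twinPrimeCurve 73).toAffine.Nonsingular x y)
    (hc : (twinPrimeCurve 73).toAffine.Nonsingular c 0) (hxc : x ≠ c) :
    ∃ (x' y' : ℚ) (h' : (twinPrimeCurve 73).toAffine.Nonsingular x' y'),
      x' = (y / (x - c)) ^ 2 + 75 - x - c ∧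
      Point.some x y h + Point.some c 0 hc = Point.some x' y' h' := by
  refine ⟨_, _, _, ?_, Point.add_of_X_ne hxc⟩
  rw [addX_eq, WeierstrassCurve.Affine.slope_of_X_ne hxc, sub_zero]

/-- The `x`-coordinate of the double of a point. -/
theorem exists_add_self {x y : ℚ} (h : (twinPrimeCurve 73).toAffine.Nonsingular x y)
    (hy : y ≠ 0) :
    ∃ (x' y' : ℚ) (h' : (twinPrimeCurve 73).toAffine.Nonsingular x' y'),
      x' = ((x ^ 2 - 146) / (2 * y)) ^ 2 ∧
      Point.some x y h + Point.some x y h = Point.some x' y' h' := by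
  have hne : y ≠ (twinPrimeCurve 73).toAffine.negY x y := by
    rw [negY_eq]; intro h; exact hy (by linarith)
  refine ⟨_, _, _, ?_, Point.add_self_of_Y_ne hne⟩
  rw [addX_eq, WeierstrassCurve.Affine.slope_of_Y_ne rfl hne, negY_eq]
  simp only [twinPrimeCurve]
  have e := nonsingular_iff.1 h
  push_cast
  have h2 : y - -y = 2 * y := by ring
  rw [h2, div_pow, div_pow]
  field_simp
  linear_combination (-4 * (2 * x - 75)) * e

theorem eq_or_eq_neg_of_x_eq {x y x' y' : ℚ} (h : (twinPrimeCurve 73).toAffine.Nonsingular x y)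
    (h' : (twinPrimeCurve 73).toAffine.Nonsingular x' y') (hx : x = x') :
    Point.some x y h = Point.some x' y' h' ∨ Point.some x y h = -Point.some x' y' h' := by
  subst hx
  rcases WeierstrassCurve.Affine.Y_eq_of_X_eq h.1 h'.1 rfl with rfl | h1
  · exact Or.inl rfl
  · right
    rw [Point.neg_some]
    subst h1
    rfl

/-- A point whose `x`-coordinate is a square is twice a point, up to the points of order two. -/
theorem exists_double_of_isSquare_x {x y : ℚ} (h : (twinPrimeCurve 73).toAffine.Nonsingular x y)
    (hx : IsSquare x) :
    ∃ Q : (twinPrimeCurve 73).toAffine.Point,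
      2 • Point.some x y h = 2 • (2 • Q) := by
  rcases eq_or_ne y 0 with rfl | hy
  · exact ⟨0, by simp [two_nsmul, some_zero_add_self h]⟩
  obtain ⟨t, ht⟩ := hx
  have e := nonsingular_iff.1 h
  have hx0 : x ≠ 0 := by rintro rfl; exact hy (by simpa using e)
  have ht0 : t ≠ 0 := by rintro rfl; exact hx0 (by simpa using ht)
  obtain ⟨w, rfl⟩ : ∃ w, y = t * w := ⟨y / t, by field_simp⟩
  subst ht
  have hw : w ^ 2 = t ^ 4 - 75 * t ^ 2 + 146 := by
    apply mul_left_cancel₀ (pow_ne_zero 2 ht0)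
    linear_combination e
  -- This is the x-coordinate of a preimage under the isogeny E' → E, (X, Y) ↦ (Y²/(4X²), …).
  have hsq : IsSquare (2 * t ^ 2 - 75 + 2 * w) := by
    refine isSquare_of_isogenous_point (y := 2 * t * (2 * t ^ 2 - 75 + 2 * w)) ?_
    linear_combination (-4 * (2 * t ^ 2 - 75 + 2 * w)) * hw
  obtain ⟨g, hg⟩ := hsq
  have hg0 : g ≠ 0 := by
    rintro rfl
    have h1 : (2 * t ^ 2 - 75 + 2 * w) * (2 * t ^ 2 - 75 - 2 * w) = 5041 := by
      linear_combination -4 * hw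
    rw [hg] at h1
    norm_num at h1
  have hg4 : g ^ 4 + 150 * g ^ 2 + 5041 = (2 * t * g) ^ 2 := by
    have h1 : 2 * w = g ^ 2 - 2 * t ^ 2 + 75 := by linear_combination hg
    have h2 : (2 * w) ^ 2 = 4 * (t ^ 4 - 75 * t ^ 2 + 146) := by rw [← hw]; ring
    rw [h1] at h2
    linear_combination h2
  -- The line y = g x through (0, 0) meets E again where u² - (75 + g²)u + 146 = 0; by `hg4` the
  -- discriminant is (2tg)².
  set u : ℚ := ((75 + g ^ 2) + 2 * t * g) / 2 with hu
  have hquad : u ^ 2 - (75 + g ^ 2) * u + 146 = 0 := by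
    rw [hu]; linear_combination (-1 / 4) * hg4
  have hu0 : u ≠ 0 := by
    intro h0; rw [h0] at hquad; norm_num at hquad
  have hQ : (twinPrimeCurve 73).toAffine.Nonsingular u (g * u) :=
    nonsingular_iff.2 (by linear_combination (-u) * hquad)
  obtain ⟨x', y', h', hx', hadd⟩ := exists_add_self hQ (mul_ne_zero hg0 hu0)
  have hxx : t * t = x' := by
    rw [hx']
    have h1 : u ^ 2 - 146 = 2 * t * (g * u) := by
      have h2 : u ^ 2 - 146 = u * (2 * u - (75 + g ^ 2)) := by linear_combination -hquad
      rw [h2, hu]; ring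
    rw [h1]
    field_simp
  rcases eq_or_eq_neg_of_x_eq h h' hxx with h1 | h1
  · exact ⟨Point.some u (g * u) hQ, by rw [h1, two_nsmul (Point.some u _ hQ), hadd]⟩
  · refine ⟨-Point.some u (g * u) hQ, ?_⟩
    rw [h1, neg_nsmul, neg_nsmul, neg_nsmul, two_nsmul (Point.some u _ hQ), hadd]

theorem exists_double_of_add {x y c : ℚ} (h : (twinPrimeCurve 73).toAffine.Nonsingular x y)
    (hc : (twinPrimeCurve 73).toAffine.Nonsingular c 0) (hxc : x ≠ c)
    (hsq : IsSquare ((y / (x - c)) ^ 2 + 75 - x - c)) :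
    ∃ Q : (twinPrimeCurve 73).toAffine.Point,
      2 • Point.some x y h = 2 • (2 • Q) := by
  obtain ⟨x', y', h', hx', hadd⟩ := exists_add_some_zero h hc hxc
  obtain ⟨Q, hQ⟩ := exists_double_of_isSquare_x h' (hx' ▸ hsq)
  refine ⟨Q, ?_⟩
  rw [← hQ, ← hadd, nsmul_add, two_nsmul (Point.some c 0 hc), some_zero_add_self, add_zero]

/-- The subgroup `2 E(ℚ)` is `2`-divisible. -/
theorem exists_two_nsmul_eq (P : (twinPrimeCurve 73).toAffine.Point) :
    ∃ Q : (twinPrimeCurve 73).toAffine.Point, 2 • P = 2 • (2 • Q) := by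
  rcases P with _ | ⟨x, y, h⟩
  · exact ⟨0, by simp [← Point.zero_def]⟩
  rcases eq_or_ne y 0 with rfl | hy
  · exact ⟨0, by simp [two_nsmul, some_zero_add_self h]⟩
  have e := nonsingular_iff.1 h
  have hx0 : x ≠ 0 := by rintro rfl; exact hy (by simpa using e)
  have hx2 : x ≠ 2 := by rintro rfl; exact hy (by simpa using e)
  have hx73 : x ≠ 73 := by rintro rfl; exact hy (by simpa using e)
  have hx2' := sub_ne_zero.2 hx2
  have hx73' := sub_ne_zero.2 hx73
  -- Adding (2, 0), (73, 0) or (0, 0) multiplies the class of x by 2, 73 or 146, so some translate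
  -- has square x.
  obtain ⟨z, hz, hxz | hxz | hxz | hxz⟩ := exists_eq_mul_sq_of_point hx0 e
  · exact exists_double_of_isSquare_x h ⟨z, by rw [hxz]; ring⟩
  · refine exists_double_of_add h (nonsingular_iff.2 (by norm_num) :
      (twinPrimeCurve 73).toAffine.Nonsingular 2 0) hx2 ⟨y / (z * (x - 2)), ?_⟩
    rw [← pow_two, div_pow, div_pow, e, mul_pow]
    have h2 : z ^ 2 = x / 2 := by rw [hxz]; ring
    rw [h2]; field_simp; ring
  · refine exists_double_of_add h (nonsingular_iff.2 (by norm_num) :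
      (twinPrimeCurve 73).toAffine.Nonsingular 73 0) hx73 ⟨y / (z * (x - 73)), ?_⟩
    rw [← pow_two, div_pow, div_pow, e, mul_pow]
    have h2 : z ^ 2 = x / 73 := by rw [hxz]; ring
    rw [h2]; field_simp; ring
  · refine exists_double_of_add h (nonsingular_iff.2 (by norm_num) :
      (twinPrimeCurve 73).toAffine.Nonsingular 0 0) hx0 ⟨1 / z, ?_⟩
    rw [← pow_two, div_pow, div_pow, e]
    have h2 : z ^ 2 = x / 146 := by rw [hxz]; ring
    rw [h2]; field_simp; ring

/-! ### 2-adic valuations and the end of the descent -/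

theorem padicValRat_two_sub {q r : ℚ} (hq : q ≠ 0) (hr : r ≠ 0) (hqr : q - r ≠ 0)
    (h : padicValRat 2 q < padicValRat 2 r) : padicValRat 2 (q - r) = padicValRat 2 q := by
  rw [sub_eq_add_neg] at *
  exact padicValRat.add_eq_of_lt hqr hq (neg_ne_zero.2 hr) (by rwa [padicValRat.neg])

/-- If `x` and `x - 2` are rational squares, then `x` is not integral at `2`. -/
theorem padicValRat_neg_of_sq_sub_sq {a b : ℚ} (h : a ^ 2 - b ^ 2 = 2) :
    padicValRat 2 (a ^ 2) < 0 := by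
  have ha0 : a ≠ 0 := by rintro rfl; nlinarith [sq_nonneg b]
  have hprod : (a - b) * (a + b) = 2 := by linear_combination h
  have hp : a - b ≠ 0 := left_ne_zero_of_mul (hprod.trans_ne two_ne_zero)
  have hq : a + b ≠ 0 := right_ne_zero_of_mul (hprod.trans_ne two_ne_zero)
  have htwo : padicValRat 2 (2 : ℚ) = 1 := by exact_mod_cast padicValRat.self (p := 2) one_lt_two
  have hsum : padicValRat 2 (a - b) + padicValRat 2 (a + b) = 1 := by
    rw [← padicValRat.mul hp hq, hprod, htwo]
  have hadd : (a - b) + (a + b) = 2 * a := by ring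
  have h2a : (a - b) + (a + b) ≠ 0 := by rw [hadd]; exact mul_ne_zero two_ne_zero ha0
  -- The valuations of a - b and a + b sum to 1, so they differ and the smaller is at most 0.
  have hmin := padicValRat.add_eq_min (p := 2) h2a hp hq (by omega)
  rw [hadd, padicValRat.mul two_ne_zero ha0, htwo] at hmin
  rw [padicValRat.pow]
  push_cast
  omega

/-- For v(x) < 0 the leading terms give 2v(y) = 3v(x) and v(x² - 146) = 2v(x); the 2 in the
denominator accounts for the drop. -/
theorem padicValRat_double {x y : ℚ} (e : y ^ 2 = x * (x - 2) * (x - 73)) (hy : y ≠ 0)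
    (hv : padicValRat 2 x < 0) :
    padicValRat 2 (((x ^ 2 - 146) / (2 * y)) ^ 2) = padicValRat 2 x - 2 := by
  have hx0 : x ≠ 0 := by rintro rfl; exact hy (by simpa using e)
  have hx2 : x - 2 ≠ 0 := by intro h; exact hy (by simpa [h] using e)
  have hx73 : x - 73 ≠ 0 := by intro h; exact hy (by simpa [h] using e)
  have hnat : ∀ n : ℕ, 0 ≤ padicValRat 2 (n : ℚ) := fun n => zero_le_padicValRat_of_nat n
  have h2 : padicValRat 2 (x - 2) = padicValRat 2 x :=
    padicValRat_two_sub hx0 two_ne_zero hx2 (hv.trans_le (hnat 2))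
  have h73 : padicValRat 2 (x - 73) = padicValRat 2 x :=
    padicValRat_two_sub hx0 (by norm_num) hx73 (hv.trans_le (hnat 73))
  have h2sq : padicValRat 2 (x ^ 2) = 2 * padicValRat 2 x := by rw [padicValRat.pow]; norm_num
  have hlt : padicValRat 2 (x ^ 2) < padicValRat 2 146 := by
    rw [h2sq]
    exact lt_of_lt_of_le (by linarith) (hnat 146)
  have hne : x ^ 2 - 146 ≠ 0 := by
    intro h
    rw [sub_eq_zero.1 h] at hlt
    exact hlt.false
  have hnum : padicValRat 2 (x ^ 2 - 146) = 2 * padicValRat 2 x := by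
    rw [padicValRat_two_sub (pow_ne_zero 2 hx0) (by norm_num) hne hlt, h2sq]
  have hyv : 2 * padicValRat 2 y = 3 * padicValRat 2 x := by
    have h1 : padicValRat 2 (y ^ 2) = 2 * padicValRat 2 y := by rw [padicValRat.pow]; norm_num
    rw [← h1, e, padicValRat.mul (mul_ne_zero hx0 hx2) hx73, padicValRat.mul hx0 hx2, h2, h73]
    ring
  have htwo : padicValRat 2 (2 : ℚ) = 1 := by exact_mod_cast padicValRat.self (p := 2) one_lt_two
  rw [padicValRat.pow, padicValRat.div hne (mul_ne_zero two_ne_zero hy),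
    padicValRat.mul two_ne_zero hy, hnum, htwo]
  push_cast
  linarith

/-- Nonzero elements of `2 E(ℚ)` are not integral at `2`. -/
theorem exists_eq_some_of_two_nsmul_ne_zero {P : (twinPrimeCurve 73).toAffine.Point}
    (hP : 2 • P ≠ 0) :
    ∃ (x y : ℚ) (h : (twinPrimeCurve 73).toAffine.Nonsingular x y),
      2 • P = Point.some x y h ∧ padicValRat 2 x < 0 := by
  rcases P with _ | ⟨x, y, h⟩
  · exact (hP (by simp [← Point.zero_def])).elim
  have hy : y ≠ 0 := by
    rintro rfl; exact hP (by rw [two_nsmul, some_zero_add_self])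
  obtain ⟨x', y', h', hx', hadd⟩ := exists_add_self h hy
  refine ⟨x', y', h', by rw [two_nsmul, hadd], ?_⟩
  rw [hx']
  -- Since (2, 0) is rational, x(2P) - 2 is a square as well as x(2P).
  refine padicValRat_neg_of_sq_sub_sq (b := (x ^ 2 - 4 * x + 146) / (2 * y)) ?_
  have e := nonsingular_iff.1 h
  rw [div_pow, div_pow]
  field_simp
  linear_combination -8 * e

theorem two_nsmul_eq_zero (P : (twinPrimeCurve 73).toAffine.Point) : 2 • P = 0 := by
  by_contra hne
  obtain ⟨x, y, h, hP, hv⟩ := exists_eq_some_of_two_nsmul_ne_zero hne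
  obtain ⟨n, hn⟩ : ∃ n : ℕ, -padicValRat 2 x ≤ n := ⟨_, Int.self_le_toNat _⟩
  induction n generalizing P x y with
  | zero => push_cast at hn; linarith
  | succ n ih =>
    obtain ⟨Q, hQ⟩ := exists_two_nsmul_eq P
    have hQne : 2 • Q ≠ 0 := fun h0 => hne (by rw [hQ, h0, nsmul_zero])
    obtain ⟨x₁, y₁, h₁, hQ₁, hv₁⟩ := exists_eq_some_of_two_nsmul_ne_zero hQne
    refine ih Q hQne x₁ y₁ h₁ hQ₁ hv₁ ?_
    have hy₁ : y₁ ≠ 0 := by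
      rintro rfl
      exact hne (by rw [hQ, hQ₁, two_nsmul, some_zero_add_self])
    obtain ⟨x', y', h', hx', hadd⟩ := exists_add_self h₁ hy₁
    have hxx : x = x' := by
      have h2 : Point.some x y h = Point.some x' y' h' := by
        rw [← hP, hQ, hQ₁, two_nsmul, hadd]
      injection h2
    have hval := padicValRat_double (nonsingular_iff.1 h₁) hy₁ hv₁
    rw [← hx', ← hxx] at hval
    push_cast at hn
    linarith

theorem mordellWeilRank_eq_zero : mordellWeilRank (twinPrimeCurve 73) = 0 := by
  rw [mordellWeilRank, rank_eq_zero_iff]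
  intro P
  refine ⟨2, two_ne_zero, ?_⟩
  have := two_nsmul_eq_zero P
  rw [two_nsmul] at this
  rw [two_zsmul, this]

end TwinPrimeCurve

theorem proposition5p1p1 :
    (IsTwinPrimePair 73 ∧ 73 ≡ 1 [MOD 8]) ∧
      (twinPrimeCurve 73).IsElliptic ∧
      mordellWeilRank (twinPrimeCurve 73) = 0 ∧
      ¬ BeersConjecture := by
  have hp : IsTwinPrimePair 73 := ⟨by norm_num, by norm_num, by norm_num⟩
  have hm : 73 ≡ 1 [MOD 8] := by decide
  refine ⟨⟨hp, hm⟩, TwinPrimeCurve.isElliptic_seventy_three,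
    TwinPrimeCurve.mordellWeilRank_eq_zero, fun hB => ?_⟩
  have h := hB 73 hp hm
  rw [TwinPrimeCurve.mordellWeilRank_eq_zero] at h
  exact two_ne_zero h.symm
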